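/- For a partition $\lambda$ and complex numbers ${\bf t}=(t_1,t_2,\dots)$ let $s_\lambda({\bf t})=\det\big(h_{\lambda_i-i+j}({\bf t})\big)_{1\le i,j\le \ell(\lambda)}$, where $\exp\sum_{m\ge1}z^mt_m=\sum_{n\ge0}z^nh_n({\bf t})$ and $h_n=0$ for $n<0$. Write $\lambda=(\alpha_1,\dots,\alpha_k|\beta_1,\dots,\beta_k)$ for the Frobenius notation: $k$ is the number of nodes on the main diagonal, $\alpha_i=\lambda_i-i$, $\beta_i=\lambda'_i-i$. Put $(a)_n=a(a+1)\cdots(a+n-1)$ and $(x;q)_n=(1-x)(1-xq)\cdots(1-xq^{n-1})$. For a positive integer $p$ and ${\bf t}=(t_1,t_2,\dots)$ let ${\bf t}^{[p]}$ be the sequence whose entry number $pm$ is $t_m$ for every $m\ge1$ and whose other entries are $0$; let ${\bf t}^{[p]}_\infty$, ${\bf t}^{[p]}(a)$, ${\bf t}^{[p]}(\infty,q)$, ${\bf t}^{[p]}(a,q)$ be obtained in this way from, respectively, ${\bf t}_\infty=(1,0,0,\dots)$ and from the sequences with $t_m=\frac am$, $t_m=\frac1{m(1-q^m)}$, $t_m=\frac{1-(q^a)^m}{m(1-q^m)}$.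 Here $a,q\in\mathbb C$, $q\ne0$, $q$ is not a root of unity, and complex powers of $q$ are principal. Lemma 2. Let $p\ge1$ and let $(\alpha^{(m)}|\beta^{(m)})=(\alpha^{(m)}_1,\dots,\alpha^{(m)}_{k^{(m)}}|\beta^{(m)}_1,\dots,\beta^{(m)}_{k^{(m)}})$, $m=1,\dots,p$, be partitions; put $k=k^{(1)}+\dots+k^{(p)}$. Let $\alpha_1>\dots>\alpha_k\ge0$ be the numbers $\alpha^{(m)}_ip+m-1$ and $\beta_1>\dots>\beta_k\ge0$ the numbers $\beta^{(m)}_ip+p-m$ ($1\le m\le p$, $1\le i\le k^{(m)}$), each put in decreasing order, and let $(\alpha|\beta)$ be the partition $(\alpha_1,\dots,\alpha_k|\beta_1,\dots,\beta_k)$. Let $$\sigma(\alpha,\beta)=I_\alpha+I_\beta+\sum_{i=1}^k\beta_i+\sum_{m=1}^p\sum_{i=1}^{k^{(m)}}\beta^{(m)}_i ,$$ where $I_\alpha$ is the number of $(m,i,m',j)$ with $m<m'$ and $\alpha^{(m)}_ip+m-1<\alpha^{(m')}_jp+m'-1$, and $I_\beta$ is the number of $(m,i,m',j)$ with $m<m'$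 and $\beta^{(m)}_ip+p-m<\beta^{(m')}_jp+p-m'$. Then $$s_{(\alpha|\beta)}({\bf t}^{[p]}_\infty)=(-1)^{\sigma(\alpha,\beta)}\prod_{m=1}^p\frac{\prod_{i<j}^{k^{(m)}}(\alpha_i^{(m)}-\alpha_j^{(m)})(\beta_i^{(m)}-\beta_j^{(m)})}{\prod_{i,j=1}^{k^{(m)}}(\alpha_i^{(m)}+\beta_j^{(m)}+1)}\cdot\frac1{\prod_{i=1}^{k^{(m)}}\alpha_i^{(m)}!\,\beta_i^{(m)}!},$$ $$s_{(\alpha|\beta)}({\bf t}^{[p]}(a))=(-1)^{\sigma(\alpha,\beta)}\prod_{m=1}^p\frac{\prod_{i<j}^{k^{(m)}}(\alpha_i^{(m)}-\alpha_j^{(m)})(\beta_i^{(m)}-\beta_j^{(m)})}{\prod_{i,j=1}^{k^{(m)}}(\alpha_i^{(m)}+\beta_j^{(m)}+1)}\prod_{i=1}^{k^{(m)}}\frac{(a)_{\alpha_i^{(m)}+1}}{\alpha_i^{(m)}!}\,\frac{(-1)^{\beta_i^{(m)}}(1-a)_{\beta_i^{(m)}}}{\beta_i^{(m)}!},$$ $$s_{(\alpha|\beta)}({\bf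 t}^{[p]}(\infty,q))=(-1)^{\sigma(\alpha,\beta)}\prod_{m=1}^p\frac{\prod_{i<j}^{k^{(m)}}(q^{\alpha_i^{(m)}+1}-q^{\alpha_j^{(m)}+1})(q^{-\beta_j^{(m)}}-q^{-\beta_i^{(m)}})}{\prod_{i,j=1}^{k^{(m)}}(q^{-\beta_i^{(m)}}-q^{\alpha_j^{(m)}+1})}\prod_{i=1}^{k^{(m)}}\frac{q^{\beta_i^{(m)}(\beta_i^{(m)}-1)/2}}{(q;q)_{\alpha_i^{(m)}}(q;q)_{\beta_i^{(m)}}},$$ $$s_{(\alpha|\beta)}({\bf t}^{[p]}(a,q))=(-1)^{\sigma(\alpha,\beta)}\prod_{m=1}^p\frac{\prod_{i<j}^{k^{(m)}}(q^{\alpha_i^{(m)}+1}-q^{\alpha_j^{(m)}+1})(q^{-\beta_j^{(m)}}-q^{-\beta_i^{(m)}})}{\prod_{i,j=1}^{k^{(m)}}(q^{-\beta_i^{(m)}}-q^{\alpha_j^{(m)}+1})}\prod_{i=1}^{k^{(m)}}\frac{(q^a;q)_{\alpha_i^{(m)}+1}}{(q;q)_{\alpha_i^{(m)}}}\,\frac{(-1)^{\beta_i^{(m)}}q^{(a-1)\beta_i^{(m)}}(q^{1-a};q)_{\beta_i^{(m)}}}{(q;q)_{\beta_i^{(m)}}}.$$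 -/

import Mathlib

/-- The elementary Schur functions `h_n(t)`, `n ∈ ℤ`, of the times `t = (t 1, t 2, …)`
(the entry `t 0` is ignored): `exp (∑_{m ≥ 1} t_m z^m) = ∑_{n ≥ 0} h_n(t) z^n`,
and `h_n = 0` for `n < 0`. -/
noncomputable def elemSchur (t : ℕ → ℂ) (n : ℤ) : ℂ :=
  if n < 0 then 0
  else PowerSeries.coeff n.toNat
    ((PowerSeries.exp ℂ).subst (PowerSeries.mk fun m => if m = 0 then 0 else t m))

/-- The Schur function `s_μ(t) = det (h_{μ_i - i + j}(t))_{1 ≤ i, j ≤ ℓ(μ)}`. -/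
noncomputable def schur (μ : YoungDiagram) (t : ℕ → ℂ) : ℂ :=
  (Matrix.of fun i j : Fin (μ.colLen 0) =>
    elemSchur t ((μ.rowLen i : ℤ) - (i : ℤ) + (j : ℤ))).det

/-- `μ = (α | β)` in the Frobenius notation: the main diagonal of `μ` has exactly `k` nodes and,
for each of them, `α i` nodes lie to the right of the `i`-th diagonal node in its row, and `β i`
nodes lie below it in its column (rows and columns are numbered from `0`). -/
def IsFrobenius (μ : YoungDiagram) {k : ℕ} (α β : Fin k → ℕ) : Prop :=
  (∀ i : ℕ, (i, i) ∈ μ ↔ i < k) ∧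
  (∀ i : Fin k, μ.rowLen i = i + 1 + α i) ∧
  (∀ i : Fin k, μ.colLen i = i + 1 + β i)

theorem strictAnti_add_le {k : ℕ} {f : Fin k → ℕ} (hf : StrictAnti f) :
    ∀ (d i : ℕ) (h : i + d < k), i + d + f ⟨i + d, h⟩ ≤ i + f ⟨i, by omega⟩
  | 0, _, _ => le_rfl
  | d + 1, i, h => by
    have h1 := strictAnti_add_le hf d i (by omega)
    have h2 : f ⟨i + (d + 1), h⟩ < f ⟨i + d, by omega⟩ := hf (Fin.mk_lt_mk.2 (by omega))
    omega

/-- Any two strictly decreasing sequences of the same length are the Frobenius coordinates of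
a partition. -/
theorem exists_isFrobenius {k : ℕ} (α β : Fin k → ℕ) (hα : StrictAnti α) (hβ : StrictAnti β) :
    ∃ μ : YoungDiagram, IsFrobenius μ α β := by
  classical
  have key : ∀ f : Fin k → ℕ, StrictAnti f → ∀ (i j : ℕ) (hj : j < k) (hij : i ≤ j),
      j + f ⟨j, hj⟩ ≤ i + f ⟨i, by omega⟩ := by
    intro f hf i j hj hij
    obtain ⟨d, rfl⟩ := Nat.exists_eq_add_of_le hij
    exact strictAnti_add_le hf d i hj
  let P : ℕ × ℕ → Prop := fun c =>
    (∃ h : c.1 < k, c.1 ≤ c.2 ∧ c.2 ≤ c.1 + α ⟨c.1, h⟩) ∨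
    (∃ h : c.2 < k, c.2 ≤ c.1 ∧ c.1 ≤ c.2 + β ⟨c.2, h⟩)
  let N : ℕ := k + (∑ i, α i) + (∑ i, β i)
  have hP : ∀ c, P c → c.1 < N ∧ c.2 < N := by
    rintro ⟨i, j⟩ (⟨h, h1, h2⟩ | ⟨h, h1, h2⟩)
    · have := Finset.single_le_sum (fun i _ => Nat.zero_le (α i)) (Finset.mem_univ ⟨i, h⟩)
      simp only [N] at *
      omega
    · have := Finset.single_le_sum (fun i _ => Nat.zero_le (β i)) (Finset.mem_univ ⟨j, h⟩)
      simp only [N] at *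
      omega
  let μ : YoungDiagram :=
    { cells := (Finset.range N ×ˢ Finset.range N).filter P
      isLowerSet := by
        rintro ⟨i, j⟩ ⟨i', j'⟩ ⟨hi, hj⟩ hc
        simp only [Finset.coe_filter, Set.mem_ofPred_eq, Finset.mem_product,
          Finset.mem_range] at hc ⊢
        simp only at hi hj
        have hc' : P (i', j') := by
          rcases hc.2 with ⟨h, h1, h2⟩ | ⟨h, h1, h2⟩
          · simp only at h h1 h2
            have a1 := key α hα i' i h hi
            rcases le_or_gt i' j' with h3 | h3
            · exact Or.inl ⟨by simp only; omega, h3, by simp only; omega⟩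
            · have a2 := key β hβ j' i h (by omega)
              exact Or.inr ⟨by simp only; omega, h3.le, by simp only; omega⟩
          · simp only at h h1 h2
            have a1 := key β hβ j' j h hj
            rcases le_or_gt j' i' with h3 | h3
            · exact Or.inr ⟨by simp only; omega, h3, by simp only; omega⟩
            · have a2 := key α hα i' j h (by omega)
              exact Or.inl ⟨by simp only; omega, h3.le, by simp only; omega⟩
        exact ⟨hP _ hc', hc'⟩ }
  have hmem : ∀ i j, (i, j) ∈ μ ↔ P (i, j) := by
    intro i j
    rw [← YoungDiagram.mem_cells]
    simp only [μ, Finset.mem_filter, Finset.mem_product, Finset.mem_range]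
    exact ⟨fun h => h.2, fun h => ⟨hP _ h, h⟩⟩
  refine ⟨μ, fun i => ?_, fun i => ?_, fun i => ?_⟩
  · rw [hmem]
    constructor
    · rintro (⟨h, -⟩ | ⟨h, -⟩) <;> exact h
    · exact fun h => Or.inl ⟨h, le_rfl, Nat.le_add_right _ _⟩
  · refine eq_of_forall_lt_iff fun j => ?_
    rw [← YoungDiagram.mem_iff_lt_rowLen, hmem]
    have hi := i.2
    constructor
    · rintro (⟨h, h1, h2⟩ | ⟨h, h1, h2⟩)
      · simp only [Fin.eta] at h1 h2
        omega
      · simp only at h1 h2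
        omega
    · intro h
      rcases le_or_gt (i : ℕ) j with h3 | h3
      · exact Or.inl ⟨hi, h3, by simp only [Fin.eta]; omega⟩
      · have a2 := key β hβ j i hi h3.le
        exact Or.inr ⟨by simp only; omega, h3.le, by simp only; omega⟩
  · refine eq_of_forall_lt_iff fun j => ?_
    rw [← YoungDiagram.mem_iff_lt_colLen, hmem]
    have hi := i.2
    constructor
    · rintro (⟨h, h1, h2⟩ | ⟨h, h1, h2⟩)
      · simp only at h1 h2
        omega
      · simp only [Fin.eta] at h1 h2
        omega
    · intro h
      rcases le_or_gt (i : ℕ) j with h3 | h3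
      · exact Or.inr ⟨hi, h3, by simp only [Fin.eta]; omega⟩
      · have a2 := key α hα j i hi h3.le
        exact Or.inl ⟨by simp only; omega, h3.le, by simp only; omega⟩

/-- The times `t_∞ = (1, 0, 0, …)`. -/
def tInf : ℕ → ℂ := fun m => if m = 1 then 1 else 0

/-- The times `t(a)`, `t_m = a / m`. -/
noncomputable def tA (a : ℂ) : ℕ → ℂ := fun m => a / m

/-- The times `t(∞, q)`, `t_m = 1 / (m (1 - q^m))`. -/
noncomputable def tInfQ (q : ℂ) : ℕ → ℂ := fun m => 1 / (m * (1 - q ^ m))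

/-- The times `t(a, q)`, `t_m = (1 - (q^a)^m) / (m (1 - q^m))`. -/
noncomputable def tAQ (a q : ℂ) : ℕ → ℂ := fun m => (1 - (q ^ a) ^ m) / (m * (1 - q ^ m))

/-- The times `t^{[p]}`: the entry with number `p m` is `t_m`, all other entries are `0`. -/
def stretch (p : ℕ) (t : ℕ → ℂ) : ℕ → ℂ := fun n => if p ∣ n then t (n / p) else 0

/-- The Pochhammer symbol `(a)_n = a (a + 1) ⋯ (a + n - 1)`. -/
def poch (a : ℂ) (n : ℕ) : ℂ := ∏ i ∈ Finset.range n, (a + i)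

/-- The `q`-Pochhammer symbol `(x; q)_n = (1 - x) (1 - x q) ⋯ (1 - x q^{n-1})`. -/
def qPoch (x q : ℂ) (n : ℕ) : ℂ := ∏ i ∈ Finset.range n, (1 - x * q ^ i)

/-- `∏_{i<j} (α_i - α_j) (β_i - β_j) / ∏_{i,j} (α_i + β_j + 1)`. -/
noncomputable def cauchyFactor {k : ℕ} (α β : Fin k → ℕ) : ℂ :=
  (∏ i, ∏ j ∈ Finset.Ioi i, ((α i : ℂ) - α j) * ((β i : ℂ) - β j)) /
    ∏ i, ∏ j, ((α i : ℂ) + β j + 1)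

/-- `∏_{i<j} (q^{α_i+1} - q^{α_j+1}) (q^{-β_j} - q^{-β_i}) /
∏_{i,j} (q^{-β_i} - q^{α_j+1})`. -/
noncomputable def qCauchyFactor (q : ℂ) {k : ℕ} (α β : Fin k → ℕ) : ℂ :=
  (∏ i, ∏ j ∈ Finset.Ioi i,
      (q ^ (α i + 1) - q ^ (α j + 1)) * (q ^ (-(β j : ℤ)) - q ^ (-(β i : ℤ)))) /
    ∏ i, ∏ j, (q ^ (-(β i : ℤ)) - q ^ (α j + 1))

/-- The exponent `σ` of the sign. The numbers `α^{(m)}_i p + m - 1` and `β^{(m)}_i p + p - m`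
(for `m = 1, …, p`; here `m` runs over `0, …, p - 1`) are written down color by color, in
decreasing order within each color. `σ` is the number of pairs that stand in increasing order in
the first list, plus the same number for the second list, plus the sum of the second list, plus
the sum of all `β^{(m)}_i`. -/
def signExponent (p : ℕ) {k : Fin p → ℕ} (A B : (m : Fin p) → Fin (k m) → ℕ) : ℕ :=
  (∑ m, ∑ m' ∈ Finset.Ioi m, ∑ i, ∑ j,
    ((if A m i * p + m < A m' j * p + m' then 1 else 0) +
      (if B m i * p + (p - 1 - m) < B m' j * p + (p - 1 - m') then 1 else 0))) +
  ∑ m, ∑ i, (B m i * p + (p - 1 - m)) + ∑ m, ∑ i, B m i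

/-! Let H(z) = ∑ h_n z^n and G = 1/H. Giambelli's formula writes s_{(α|β)}, up to the sign
(-1)^{∑β_i}, as the determinant of the hook sums ∑_{j≤b} h_{a+1+j} g_{b-j} at a = α_i, b = β_j
(`schur_eq_det_hookSum`).

Passing to t^{[p]} replaces H(z), G(z) by H(z^p), G(z^p). A hook sum then vanishes unless the
residues of α_i and β_j modulo p add up to p - 1, that is, unless both come from the same m
("colour"); in that case it is the unstretched hook sum of the quotients (`hookSum_stretch`).
Sorting rows and columns by colour thus makes the matrix block diagonal; the two sorting
permutations contribute I_α and I_β to the sign (`sign_merge`, `schur_stretch`).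

For each specialization the hook sum factors as (function of a) · (function of b) / (a + b + 1), or
with 1 - q^{a+b+1} in the denominator (`hookSum_geometric`, `hookSum_quantum`), so every block is a
rescaled Cauchy matrix. Two families suffice: m t_m = u v^{m-1} covers t_∞ and t(a), and m (1 - q^m)
t_m = 1 - x^m covers t(∞,q) and t(a,q). -/

/-! ### The generating series of the h_n -/

open PowerSeries in
theorem constantCoeff_exp_subst {T : PowerSeries ℂ} (hT : constantCoeff T = 0) :
    constantCoeff (R := ℂ) ((PowerSeries.exp ℂ).subst T) = 1 := by
  refine (constantCoeff_subst (HasSubst.of_constantCoeff_zero' hT) _).trans ?_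
  rw [finsum_eq_single _ 0]
  · simp
  · intro n hn
    have h : MvPowerSeries.constantCoeff T = 0 := hT
    simp [h, hn]

-- Both sides solve the linear equation F' = T'F with F(0) = 1, so their quotient has zero
-- derivative. Closed forms of H are verified through this equation.
open PowerSeries in
theorem exp_subst_eq_of_derivative {T H : PowerSeries ℂ} (hT : constantCoeff T = 0)
    (hH : constantCoeff H = 1) (hd : d⁄dX ℂ H = d⁄dX ℂ T * H) :
    (PowerSeries.exp ℂ).subst T = H := by
  have hs : HasSubst T := HasSubst.of_constantCoeff_zero' hT
  have hH0 : constantCoeff H ≠ 0 := by rw [hH]; exact one_ne_zero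
  set E := (PowerSeries.exp ℂ).subst T with hE
  have hE' : d⁄dX ℂ E = d⁄dX ℂ T * E := by
    rw [hE, derivative_subst hs, derivative_exp, mul_comm]
  have hE0 : constantCoeff E = 1 := constantCoeff_exp_subst hT
  have hinv : H * H⁻¹ = 1 := PowerSeries.mul_inv_cancel H hH0
  have h1 : E * H⁻¹ = 1 := by
    apply derivative.ext
    · rw [Derivation.leibniz, derivative_inv', hE', hd, derivative_one]
      simp only [smul_eq_mul]
      linear_combination (-(E * H⁻¹ * d⁄dX ℂ T)) * hinv
    · simp [hE0, hH]
  calc E = E * (H * H⁻¹) := by rw [hinv, mul_one]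
    _ = (E * H⁻¹) * H := by ring
    _ = H := by rw [h1, one_mul]

/-- The series `∑_{m ≥ 1} t_m z^m`. -/
noncomputable def timeSeries (t : ℕ → ℂ) : PowerSeries ℂ :=
  PowerSeries.mk fun m => if m = 0 then 0 else t m

/-- The series `∑_{n ≥ 0} h_n(t) z^n`. -/
noncomputable def schurSeries (t : ℕ → ℂ) : PowerSeries ℂ :=
  (PowerSeries.exp ℂ).subst (timeSeries t)

theorem elemSchur_natCast (t : ℕ → ℂ) (n : ℕ) :
    elemSchur t n = PowerSeries.coeff n (schurSeries t) := by
  rw [elemSchur, if_neg (by omega)]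
  rfl

theorem elemSchur_of_neg (t : ℕ → ℂ) {n : ℤ} (hn : n < 0) : elemSchur t n = 0 := if_pos hn

theorem constantCoeff_timeSeries (t : ℕ → ℂ) :
    PowerSeries.constantCoeff (timeSeries t) = 0 := by
  rw [← PowerSeries.coeff_zero_eq_constantCoeff_apply, timeSeries, PowerSeries.coeff_mk, if_pos rfl]

/-- The stretched times have the series T(z^p), and exp(T(z^p)) is exp(T) evaluated at z^p. -/
theorem schurSeries_stretch {p : ℕ} (hp : p ≠ 0) (t : ℕ → ℂ) :
    schurSeries (stretch p t) = PowerSeries.expand p hp (schurSeries t) := by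
  have hs : PowerSeries.HasSubst (timeSeries t) :=
    PowerSeries.HasSubst.of_constantCoeff_zero' (constantCoeff_timeSeries t)
  have h := PowerSeries.expand_subst p hp hs (PowerSeries.exp ℂ)
  have h2 : timeSeries (stretch p t) = PowerSeries.expand p hp (timeSeries t) := by
    ext n
    rw [PowerSeries.coeff_expand]
    simp only [timeSeries, PowerSeries.coeff_mk, stretch]
    by_cases hd : p ∣ n
    · obtain ⟨c, rfl⟩ := hd
      simp [hp]
    · have : n ≠ 0 := by rintro rfl; exact hd (dvd_zero _)
      simp [hd, this]
  rw [schurSeries, h2]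
  exact h.symm

open PowerSeries in
theorem coeff_derivative_timeSeries (t : ℕ → ℂ) (n : ℕ) :
    coeff n (d⁄dX ℂ (timeSeries t)) = t (n + 1) * (n + 1) := by
  rw [coeff_derivative, timeSeries, coeff_mk, if_neg (Nat.succ_ne_zero n)]

open PowerSeries in
/-- If `m t_m = u v^{m-1}` then `h_n = u (u + v) ⋯ (u + (n - 1) v) / n!`. -/
theorem schurSeries_of_geometric (t : ℕ → ℂ) (u v : ℂ)
    (ht : ∀ n : ℕ, t (n + 1) * (n + 1) = u * v ^ n) :
    schurSeries t = mk fun n => (∏ i ∈ Finset.range n, (u + v * i)) / n.factorial := by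
  set H : PowerSeries ℂ := mk fun n => (∏ i ∈ Finset.range n, (u + v * i)) / n.factorial with hH
  apply exp_subst_eq_of_derivative (constantCoeff_timeSeries t)
  · rw [← coeff_zero_eq_constantCoeff_apply, hH, coeff_mk]; simp
  -- The recursion (n + 1) h_{n+1} = (u + v n) h_n reads (1 - vz) H' = uH. As (1 - vz) T' = u as
  -- well, cancelling 1 - vz gives H' = T'H.
  have h1 : d⁄dX ℂ H * (1 - C v * X) = C u * H := by
    ext n
    have hrec : ∀ n : ℕ, coeff (n + 1) H * (n + 1) = (u + v * n) * coeff n H := by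
      intro n
      rw [hH, coeff_mk, coeff_mk, Finset.prod_range_succ, Nat.factorial_succ]
      have h1 : ((n : ℂ) + 1) ≠ 0 := by exact_mod_cast Nat.succ_ne_zero n
      have h2 : (n.factorial : ℂ) ≠ 0 := by exact_mod_cast n.factorial_ne_zero
      push_cast
      field_simp
    rw [mul_sub, mul_one, map_sub, coeff_derivative, hrec, coeff_C_mul,
      show d⁄dX ℂ H * (C v * X) = C v * (d⁄dX ℂ H * X) by ring, coeff_C_mul]
    cases n with
    | zero => simp
    | succ n =>
      rw [coeff_succ_mul_X, coeff_derivative]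
      push_cast
      ring
  have h2 : d⁄dX ℂ (timeSeries t) * (1 - C v * X) = C u := by
    ext n
    rw [mul_sub, mul_one, map_sub, coeff_derivative_timeSeries, ht,
      show d⁄dX ℂ (timeSeries t) * (C v * X) = C v * (d⁄dX ℂ (timeSeries t) * X) by ring,
      coeff_C_mul]
    cases n with
    | zero => simp
    | succ n =>
      rw [coeff_succ_mul_X, coeff_derivative_timeSeries, ht, coeff_C, if_neg (Nat.succ_ne_zero n)]
      ring
  have h3 : (1 - C v * X : PowerSeries ℂ) ≠ 0 := by
    intro h
    simpa using congrArg constantCoeff h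
  apply mul_right_cancel₀ h3
  linear_combination h1 - H * h2

open PowerSeries in
theorem derivative_rescale (q : ℂ) (f : PowerSeries ℂ) :
    d⁄dX ℂ (rescale q f) = C q * rescale q (d⁄dX ℂ f) := by
  ext n
  rw [coeff_derivative, coeff_rescale, coeff_C_mul, coeff_rescale, coeff_derivative]
  ring

open PowerSeries in
theorem derivative_schurSeries (t : ℕ → ℂ) :
    d⁄dX ℂ (schurSeries t) = d⁄dX ℂ (timeSeries t) * schurSeries t := by
  rw [schurSeries, derivative_subst
    (HasSubst.of_constantCoeff_zero' (constantCoeff_timeSeries t)), derivative_exp, mul_comm]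

open PowerSeries in
theorem constantCoeff_schurSeries (t : ℕ → ℂ) : constantCoeff (schurSeries t) = 1 :=
  constantCoeff_exp_subst (constantCoeff_timeSeries t)

open PowerSeries in
theorem mk_pow_mul_one_sub (x : ℂ) : (mk fun n => x ^ n) * (1 - C x * X) = 1 := by
  ext n
  rw [mul_sub, mul_one, map_sub, coeff_mk,
    show (mk fun n => x ^ n) * (C x * X) = C x * ((mk fun n => x ^ n) * X) by ring, coeff_C_mul]
  cases n with
  | zero => simp
  | succ n =>
    rw [coeff_succ_mul_X, coeff_mk, coeff_one, if_neg (Nat.succ_ne_zero n)]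
    ring

open PowerSeries in
/-- If `m (1 - q^m) t_m = 1 - x^m` then the series `H` of the `h_n` satisfies
`(1 - z) H(z) = (1 - x z) H(q z)`. -/
theorem schurSeries_functional_equation (t : ℕ → ℂ) (q x : ℂ)
    (ht : ∀ n : ℕ, t (n + 1) * (n + 1) * (1 - q ^ (n + 1)) = 1 - x ^ (n + 1)) :
    schurSeries t * (1 - X) = rescale q (schurSeries t) * (1 - C x * X) := by
  set E := schurSeries t with hE
  set U : PowerSeries ℂ := mk fun n => 1 ^ n with hU
  set V : PowerSeries ℂ := mk fun n => x ^ n with hV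
  have hU1 : U * (1 - X) = 1 := by
    simpa only [map_one, one_mul] using mk_pow_mul_one_sub 1
  have hV1 : V * (1 - C x * X) = 1 := mk_pow_mul_one_sub x
  have hU' : d⁄dX ℂ U = U * U := by
    have h := congrArg (d⁄dX ℂ) hU1
    rw [Derivation.leibniz, map_sub, derivative_one, derivative_X] at h
    simp only [smul_eq_mul] at h
    linear_combination U * h - d⁄dX ℂ U * hU1
  -- The hypothesis on the times, summed over n: T'(z) - q T'(qz) = 1/(1 - z) - x/(1 - xz), with U =
  -- 1/(1 - z) and V = 1/(1 - xz).
  have hT : d⁄dX ℂ (timeSeries t) = C q * rescale q (d⁄dX ℂ (timeSeries t)) + U - C x * V := by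
    ext n
    rw [map_sub, map_add, coeff_C_mul, coeff_C_mul, coeff_rescale, coeff_derivative_timeSeries,
      hU, hV, coeff_mk, coeff_mk]
    linear_combination ht n
  have hσ : d⁄dX ℂ (rescale q E) = C q * rescale q (d⁄dX ℂ (timeSeries t)) * rescale q E := by
    rw [derivative_rescale, hE, derivative_schurSeries, map_mul, mul_assoc]
  obtain ⟨D, hD⟩ : ∃ D, D = C q * rescale q (d⁄dX ℂ (timeSeries t)) := ⟨_, rfl⟩
  rw [← hD] at hT hσ
  -- By `hT` the right-hand side has logarithmic derivative T', so it is exp T.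
  have key : E = rescale q E * (1 - C x * X) * U := by
    apply exp_subst_eq_of_derivative (constantCoeff_timeSeries t)
    · have h0 : constantCoeff (rescale q E) = 1 := by
        rw [← coeff_zero_eq_constantCoeff_apply, coeff_rescale, coeff_zero_eq_constantCoeff_apply,
          hE, constantCoeff_schurSeries]
        simp
      have h1 : constantCoeff U = 1 := by
        rw [← coeff_zero_eq_constantCoeff_apply, hU, coeff_mk]; simp
      rw [map_mul, map_mul, h0, h1]
      simp
    · rw [Derivation.leibniz, Derivation.leibniz, hσ, hU', hT]
      have h4 : d⁄dX ℂ (1 - C x * X) = - C x := by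
        rw [map_sub, Derivation.leibniz]; simp
      rw [h4]
      simp only [smul_eq_mul]
      linear_combination (C x * rescale q E * U) * hV1
  calc E * (1 - X) = rescale q E * (1 - C x * X) * U * (1 - X) := by rw [← key]
    _ = _ := by rw [mul_assoc, hU1, mul_one]

open PowerSeries in
/-- If `m (1 - q^m) t_m = 1 - x^m` then `h_n = (x; q)_n / (q; q)_n`. -/
theorem coeff_schurSeries_of_q (t : ℕ → ℂ) (q x : ℂ) (hq : ∀ n : ℕ, 0 < n → q ^ n ≠ 1)
    (ht : ∀ n : ℕ, t (n + 1) * (n + 1) * (1 - q ^ (n + 1)) = 1 - x ^ (n + 1)) (n : ℕ) :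
    coeff n (schurSeries t) = qPoch x q n / qPoch q q n := by
  induction n with
  | zero => simp [constantCoeff_schurSeries, qPoch]
  | succ n ih =>
    -- The coefficient of z^{n+1} gives (1 - q^{n+1}) h_{n+1} = (1 - x q^n) h_n.
    have h := congrArg (coeff (n + 1)) (schurSeries_functional_equation t q x ht)
    rw [mul_sub, mul_one, map_sub, coeff_succ_mul_X, mul_sub, mul_one, map_sub,
      show ∀ f : PowerSeries ℂ, f * (C x * X) = C x * (f * X) by intro f; ring, coeff_C_mul,
      coeff_succ_mul_X, coeff_rescale, coeff_rescale, ih] at h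
    have h1 : 1 - q ^ (n + 1) ≠ 0 := sub_ne_zero.2 (hq _ n.succ_pos).symm
    have h2 : coeff (n + 1) (schurSeries t) * (1 - q ^ (n + 1)) =
        qPoch x q n / qPoch q q n * (1 - x * q ^ n) := by linear_combination h
    rw [eq_div_of_mul_eq h1 h2]
    simp only [qPoch, Finset.prod_range_succ]
    rw [← pow_succ' q n, div_mul_eq_mul_div, div_div]

/-! ### Hook sums and their closed forms -/

/-- `∑_{j ≤ b} h_{a+1+j} g_{b-j}`; when `∑ g_n z^n` is inverse to `∑ h_n z^n`, this is
`(-1)^b` times the Schur function of the hook `(a | b)`. -/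
def hookSum (h g : ℕ → ℂ) (a b : ℕ) : ℂ :=
  ∑ j ∈ Finset.range (b + 1), h (a + 1 + j) * g (b - j)

theorem hookSum_zero (h g : ℕ → ℂ) (a : ℕ) : hookSum h g a 0 = h (a + 1) * g 0 := by
  simp [hookSum]

/-- Splitting off the term j = 0 shortens the leg and lengthens the arm; this drives the inductions
on b, in which a must stay general. -/
theorem hookSum_succ (h g : ℕ → ℂ) (a b : ℕ) :
    hookSum h g a (b + 1) = h (a + 1) * g (b + 1) + hookSum h g (a + 1) b := by
  rw [hookSum, Finset.sum_range_succ', add_comm]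
  congr 1
  refine Finset.sum_congr rfl fun j _ => ?_
  rw [show a + 1 + (j + 1) = a + 1 + 1 + j by omega, Nat.add_sub_add_right]

/-- Since h_0 = 1, the coefficient of z^{n+1} in HG is g_{n+1} plus the hook sum with arm 0 and leg
n. The closed form of the hook sums therefore also proves that G inverts H. -/
theorem mk_mul_mk_eq_one {h g : ℕ → ℂ} (h0 : h 0 = 1) (g0 : g 0 = 1)
    (hs : ∀ n, g (n + 1) + hookSum h g 0 n = 0) :
    PowerSeries.mk h * PowerSeries.mk g = 1 := by
  ext n
  rw [PowerSeries.coeff_mul, Finset.Nat.sum_antidiagonal_eq_sum_range_succ_mk,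
    PowerSeries.coeff_one]
  simp only [PowerSeries.coeff_mk]
  cases n with
  | zero => simp [h0, g0]
  | succ n =>
    rw [if_neg (Nat.succ_ne_zero n), Finset.sum_range_succ', ← hs n, hookSum, add_comm, h0,
      one_mul, Nat.sub_zero]
    congr 1
    refine Finset.sum_congr rfl fun j _ => ?_
    rw [Nat.add_sub_add_right, show 0 + 1 + j = j + 1 by omega]

section Geometric

variable (u v : ℂ)

theorem prod_range_succ_neg_add (b : ℕ) :
    ∏ i ∈ Finset.range (b + 1), (-u + v * i) =
      (-1) ^ (b + 1) * u * ∏ i ∈ Finset.range b, (u - v * (i + 1)) := by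
  rw [Finset.prod_range_succ', pow_succ]
  have : ∏ i ∈ Finset.range b, (-u + v * ((i + 1 : ℕ) : ℂ)) =
      (-1) ^ b * ∏ i ∈ Finset.range b, (u - v * (i + 1)) := by
    rw [← Finset.card_range b, ← Finset.prod_const, Finset.card_range,
      ← Finset.prod_mul_distrib]
    exact Finset.prod_congr rfl fun i _ => by push_cast; ring
  rw [this]
  push_cast
  ring

/-- In the induction the common products factor out and a rational identity remains. Apart from 1/(a
+ b + 1), every factor depends on a alone or on b alone: this is what produces a Cauchy matrix. -/
theorem hookSum_geometric (a b : ℕ) :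
    hookSum (fun n => (∏ i ∈ Finset.range n, (u + v * i)) / n.factorial)
      (fun n => (∏ i ∈ Finset.range n, (-u + v * i)) / n.factorial) a b =
    (-1) ^ b * ((∏ i ∈ Finset.range (a + 1), (u + v * i)) / a.factorial *
      ((∏ i ∈ Finset.range b, (u - v * (i + 1))) / b.factorial) * (1 / (a + b + 1))) := by
  induction b generalizing a with
  | zero =>
    rw [hookSum_zero]
    have h1 : ((a : ℂ) + 1) ≠ 0 := by exact_mod_cast a.succ_ne_zero
    have h2 : (a.factorial : ℂ) ≠ 0 := by exact_mod_cast a.factorial_ne_zero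
    rw [Nat.factorial_succ]
    push_cast
    simp only [Finset.range_zero, Finset.prod_empty, Nat.factorial_zero, Nat.cast_one, pow_zero,
      add_zero]
    field_simp
  | succ b ih =>
    rw [hookSum_succ, ih]
    have h1 : ((a : ℂ) + 1) ≠ 0 := by exact_mod_cast a.succ_ne_zero
    have h2 : (a.factorial : ℂ) ≠ 0 := by exact_mod_cast a.factorial_ne_zero
    have h3 : ((b : ℂ) + 1) ≠ 0 := by exact_mod_cast b.succ_ne_zero
    have h4 : (b.factorial : ℂ) ≠ 0 := by exact_mod_cast b.factorial_ne_zero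
    have h5 : ((a : ℂ) + b + 2) ≠ 0 := by exact_mod_cast (a + b + 1).succ_ne_zero
    simp only [prod_range_succ_neg_add]
    rw [Finset.prod_range_succ _ (a + 1), Finset.prod_range_succ _ b]
    generalize ∏ i ∈ Finset.range (a + 1), (u + v * i) = P
    generalize ∏ i ∈ Finset.range b, (u - v * ((i : ℂ) + 1)) = Q
    rw [Nat.factorial_succ, Nat.factorial_succ]
    push_cast
    rw [show (a : ℂ) + 1 + b + 1 = a + b + 2 by ring, show (a : ℂ) + (b + 1) + 1 = a + b + 2 by ring]
    field_simp
    ring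

/-- Here H = (1 - vz)^{-u/v} (e^{uz} if v = 0), so the inverse is obtained by changing the sign of
u. -/
theorem mk_mul_mk_geometric :
    PowerSeries.mk (fun n => (∏ i ∈ Finset.range n, (u + v * i)) / n.factorial) *
      PowerSeries.mk (fun n => (∏ i ∈ Finset.range n, (-u + v * i)) / n.factorial) = 1 := by
  refine mk_mul_mk_eq_one (by simp) (by simp) fun n => ?_
  rw [hookSum_geometric]
  rw [prod_range_succ_neg_add, Nat.factorial_succ]
  have h3 : ((n : ℂ) + 1) ≠ 0 := by exact_mod_cast n.succ_ne_zero
  have h4 : (n.factorial : ℂ) ≠ 0 := by exact_mod_cast n.factorial_ne_zero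
  simp
  field_simp
  ring

end Geometric

section Quantum

variable {q : ℂ} (x : ℂ)

theorem qPoch_self_ne_zero (hq : ∀ n : ℕ, 0 < n → q ^ n ≠ 1) (n : ℕ) : qPoch q q n ≠ 0 := by
  refine Finset.prod_ne_zero_iff.2 fun i _ => ?_
  rw [← pow_succ']
  exact sub_ne_zero.2 (hq _ i.succ_pos).symm

theorem qPoch_succ (x q : ℂ) (n : ℕ) : qPoch x q (n + 1) = qPoch x q n * (1 - x * q ^ n) :=
  Finset.prod_range_succ _ _

theorem prod_range_succ_sub_pow (q x : ℂ) (b : ℕ) :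
    ∏ i ∈ Finset.range (b + 1), (x - q ^ i) =
      (-1) ^ (b + 1) * (1 - x) * ∏ i ∈ Finset.range b, (q ^ (i + 1) - x) := by
  rw [Finset.prod_range_succ', pow_succ]
  have : ∏ i ∈ Finset.range b, (x - q ^ (i + 1)) =
      (-1) ^ b * ∏ i ∈ Finset.range b, (q ^ (i + 1) - x) := by
    rw [← Finset.card_range b, ← Finset.prod_const, Finset.card_range,
      ← Finset.prod_mul_distrib]
    exact Finset.prod_congr rfl fun i _ => by ring
  rw [this]
  ring

theorem hookSum_quantum (hq : ∀ n : ℕ, 0 < n → q ^ n ≠ 1) (a b : ℕ) :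
    hookSum (fun n => qPoch x q n / qPoch q q n)
      (fun n => (∏ i ∈ Finset.range n, (x - q ^ i)) / qPoch q q n) a b =
    (-1) ^ b * (qPoch x q (a + 1) / qPoch q q a *
      ((∏ i ∈ Finset.range b, (q ^ (i + 1) - x)) / qPoch q q b) * (1 / (1 - q ^ (a + b + 1)))) := by
  have hne : ∀ n : ℕ, 1 - q ^ (n + 1) ≠ 0 := fun n => sub_ne_zero.2 (hq _ n.succ_pos).symm
  induction b generalizing a with
  | zero =>
    rw [hookSum_zero]
    have h1 := hne a
    have h2 := qPoch_self_ne_zero hq a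
    rw [qPoch_succ q q a, ← pow_succ', show qPoch q q 0 = 1 by simp [qPoch]]
    simp only [Finset.range_zero, Finset.prod_empty, pow_zero, add_zero]
    field_simp
  | succ b ih =>
    rw [hookSum_succ, ih]
    have h1 := hne a
    have h2 := qPoch_self_ne_zero hq a
    have h3 := hne b
    have h4 := qPoch_self_ne_zero hq b
    have h5 := hne (a + b + 1)
    simp only [prod_range_succ_sub_pow]
    rw [qPoch_succ x q (a + 1), Finset.prod_range_succ _ b, qPoch_succ q q a, qPoch_succ q q b]
    generalize qPoch x q (a + 1) = P
    generalize ∏ i ∈ Finset.range b, (q ^ (i + 1) - x) = Q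
    rw [← pow_succ', ← pow_succ', show a + 1 + b + 1 = a + b + 1 + 1 by omega,
      show a + (b + 1) + 1 = a + b + 1 + 1 by omega]
    field_simp
    ring

/-- For |q| < 1 this is H = (xz;q)_∞/(z;q)_∞, and the second factor is the q-binomial expansion of
(z;q)_∞/(xz;q)_∞. The proof is algebraic and needs no convergence. -/
theorem mk_mul_mk_quantum (hq : ∀ n : ℕ, 0 < n → q ^ n ≠ 1) :
    PowerSeries.mk (fun n => qPoch x q n / qPoch q q n) *
      PowerSeries.mk (fun n => (∏ i ∈ Finset.range n, (x - q ^ i)) / qPoch q q n) = 1 := by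
  refine mk_mul_mk_eq_one (by simp [qPoch]) (by simp [qPoch]) fun n => ?_
  have h3 : 1 - q ^ (n + 1) ≠ 0 := sub_ne_zero.2 (hq _ n.succ_pos).symm
  have h4 := qPoch_self_ne_zero hq n
  rw [hookSum_quantum x hq, prod_range_succ_sub_pow, qPoch_succ q q n, ← pow_succ',
    show qPoch x q (0 + 1) = 1 - x by simp [qPoch], show qPoch q q 0 = 1 by simp [qPoch], zero_add]
  field_simp
  ring

end Quantum

/-! ### The Cauchy determinant -/

/-- The Cauchy determinant. -/
theorem det_cauchy {F : Type*} [Field F] : ∀ {n : ℕ} (x y : Fin n → F)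
    (_ : ∀ i j, y j - x i ≠ 0),
    (Matrix.of fun i j => 1 / (y j - x i)).det =
      (∏ i, ∏ j ∈ Finset.Ioi i, (x i - x j) * (y j - y i)) / ∏ i, ∏ j, (y i - x j)
  | 0, _, _, _ => by simp
  | n + 1, x, y, hxy => by
    -- The result of subtracting (y_0 - x_0)/(y_0 - x_i) times row 0 from each row i > 0. This
    -- clears column 0, and the remaining minor is a smaller Cauchy matrix with rescaled rows and
    -- columns.
    let B : Matrix (Fin (n + 1)) (Fin (n + 1)) F := Matrix.of fun i j =>
      if i = 0 then 1 / (y j - x 0)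
      else (x 0 - x i) * (y j - y 0) / ((y j - x i) * (y 0 - x i) * (y j - x 0))
    have h1 : (Matrix.of fun i j => 1 / (y j - x i)).det = B.det := by
      refine Matrix.det_eq_of_forall_row_eq_smul_add_const
        (fun i => if i = 0 then 0 else (y 0 - x 0) / (y 0 - x i)) 0 (by simp) fun i j => ?_
      simp only [B, Matrix.of_apply, if_true]
      split_ifs with hi
      · simp [hi]
      · have := hxy i j
        have := hxy i 0
        have := hxy 0 j
        field_simp
        ring
    have hC : B.submatrix Fin.succ Fin.succ = Matrix.of fun i j : Fin n =>
        ((x 0 - x i.succ) / (y 0 - x i.succ)) *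
          ((Matrix.of fun i j : Fin n => ((y j.succ - y 0) / (y j.succ - x 0)) *
            (Matrix.of fun i j : Fin n => 1 / (y j.succ - x i.succ)) i j) i j) := by
      ext i j
      simp only [B, Matrix.submatrix_apply, Matrix.of_apply, if_neg (Fin.succ_ne_zero i)]
      have := hxy i.succ j.succ
      have := hxy i.succ 0
      have := hxy 0 j.succ
      field_simp
    have h2 : B.det = 1 / (y 0 - x 0) * (B.submatrix Fin.succ Fin.succ).det := by
      rw [Matrix.det_succ_column_zero, Fin.sum_univ_succ, Finset.sum_eq_zero]
      · have : B.submatrix (Fin.succAbove 0) Fin.succ = B.submatrix Fin.succ Fin.succ := by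
          ext i j; simp
        rw [this]
        simp [B]
      · intro i _
        simp [B]
    rw [h1, h2, hC, Matrix.det_mul_column, Matrix.det_mul_row,
      det_cauchy _ _ (fun i j => hxy i.succ j.succ)]
    simp only [Fin.prod_univ_succ, Fin.Ioi_zero_eq_map, Finset.prod_map, Fin.prod_Ioi_succ,
      Fin.coe_succEmb]
    simp only [Finset.prod_div_distrib, Finset.prod_mul_distrib]
    have e0 := hxy 0 0
    have e1 : ∏ i : Fin n, (y 0 - x i.succ) ≠ 0 := Finset.prod_ne_zero_iff.2 fun i _ => hxy _ _
    have e2 : ∏ i : Fin n, (y i.succ - x 0) ≠ 0 := Finset.prod_ne_zero_iff.2 fun i _ => hxy _ _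
    have e3 : ∏ i : Fin n, ∏ j : Fin n, (y i.succ - x j.succ) ≠ 0 :=
      Finset.prod_ne_zero_iff.2 fun i _ => Finset.prod_ne_zero_iff.2 fun j _ => hxy _ _
    field_simp

/-! ### Frobenius coordinates and the permutation of the legs -/

namespace IsFrobenius

variable {lam : YoungDiagram} {k : ℕ} {α β : Fin k → ℕ}

theorem strictAnti_left (hF : IsFrobenius lam α β) : StrictAnti α := by
  intro i j hij
  have h1 := lam.rowLen_anti i j (le_of_lt hij)
  rw [hF.2.1 i, hF.2.1 j] at h1
  have : (i : ℕ) < j := hij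
  omega

theorem strictAnti_right (hF : IsFrobenius lam α β) : StrictAnti β := by
  intro i j hij
  have h1 := lam.colLen_anti i j (le_of_lt hij)
  rw [hF.2.2 i, hF.2.2 j] at h1
  have : (i : ℕ) < j := hij
  omega

theorem le_colLen (hF : IsFrobenius lam α β) : k ≤ lam.colLen 0 := by
  by_contra! h
  have h1 := (hF.1 (lam.colLen 0)).2 h
  exact absurd (YoungDiagram.mem_iff_lt_colLen.1 (lam.up_left_mem le_rfl (Nat.zero_le _) h1))
    (lt_irrefl _)

theorem rowLen_le (hF : IsFrobenius lam α β) {i : ℕ} (hi : k ≤ i) : lam.rowLen i ≤ i := by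
  by_contra! h
  exact absurd ((hF.1 i).1 (YoungDiagram.mem_iff_lt_rowLen.2 h)) (by omega)

theorem lt_colLen (hF : IsFrobenius lam α β) {i j : ℕ} (hij : i ≤ j) (hj : j < k) :
    j < lam.colLen i :=
  YoungDiagram.mem_iff_lt_colLen.1 (lam.up_left_mem le_rfl hij ((hF.1 j).2 hj))

/-- The numbers `β_i` followed by the numbers `i - λ_i` with `i ≥ k`. -/
def legOrder (hF : IsFrobenius lam α β) {n : ℕ} (hn : lam.colLen 0 = n) (i : Fin n) : Fin n :=
  if h : (i : ℕ) < k then ⟨β ⟨i, h⟩, by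
    have h1 := hF.2.2 ⟨i, h⟩
    have h2 := lam.colLen_anti 0 i (Nat.zero_le _)
    simp only at h1
    omega⟩
  else ⟨i - lam.rowLen i, by omega⟩

variable (hF : IsFrobenius lam α β) {n : ℕ} (hn : lam.colLen 0 = n)

-- Positions i < j are inverted exactly when i < k and (j, i) is a node of the diagram, necessarily
-- below the diagonal. Strictness in both cases also gives injectivity.
include hF hn in
theorem legOrder_lt {i j : Fin n} (hij : i < j) :
    ((i : ℕ) < k ∧ (j : ℕ) < lam.colLen i ∧ hF.legOrder hn j < hF.legOrder hn i) ∨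
      (¬ ((i : ℕ) < k ∧ (j : ℕ) < lam.colLen i) ∧ hF.legOrder hn i < hF.legOrder hn j) := by
  have hij' : (i : ℕ) < j := hij
  have hmem : (i : ℕ) < lam.rowLen j ↔ (j : ℕ) < lam.colLen i := by
    rw [← YoungDiagram.mem_iff_lt_rowLen, YoungDiagram.mem_iff_lt_colLen]
  by_cases hi : (i : ℕ) < k
  · have h1 := hF.2.2 ⟨i, hi⟩
    simp only at h1
    by_cases hj : (j : ℕ) < k
    · refine Or.inl ⟨hi, hF.lt_colLen hij'.le hj, ?_⟩
      simp only [legOrder, hi, hj, dif_pos, Fin.mk_lt_mk]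
      exact hF.strictAnti_right (Fin.mk_lt_mk.2 hij')
    · have h2 := hF.rowLen_le (not_lt.1 hj)
      simp only [legOrder, hi, hj, dif_pos, dif_neg, not_false_eq_true, Fin.mk_lt_mk, true_and]
      omega
  · have h2 := hF.rowLen_le (not_lt.1 hi)
    have h3 := hF.rowLen_le (show k ≤ j by omega)
    have h4 := lam.rowLen_anti i j hij'.le
    have hj : ¬ (j : ℕ) < k := by omega
    refine Or.inr ⟨fun h => hi h.1, ?_⟩
    simp only [legOrder, hi, hj, dif_neg, not_false_eq_true, Fin.mk_lt_mk]
    omega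

theorem legOrder_injective : Function.Injective (hF.legOrder hn) := by
  intro i j hij
  rcases lt_trichotomy i j with h | h | h
  · rcases hF.legOrder_lt hn h with ⟨-, -, h'⟩ | ⟨-, h'⟩ <;> exact absurd hij (by simp [h'.ne, h'.ne'])
  · exact h
  · rcases hF.legOrder_lt hn h with ⟨-, -, h'⟩ | ⟨-, h'⟩ <;> exact absurd hij (by simp [h'.ne, h'.ne'])

/-- `legOrder` as a permutation. -/
noncomputable def legPerm : Equiv.Perm (Fin n) :=
  Equiv.ofBijective _ (Finite.injective_iff_bijective.1 (hF.legOrder_injective hn))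

/-- The inversions whose first position is i < k correspond to the β_i nodes below the diagonal in
column i; no inversion starts at i ≥ k. -/
theorem sign_legPerm {d : ℕ} (hn : lam.colLen 0 = k + d) :
    Equiv.Perm.sign (hF.legPerm hn) = (-1) ^ ∑ i, β i := by
  rw [Equiv.Perm.sign_eq_prod_prod_Ioi]
  have h : ∀ i : Fin (k + d), (∏ j ∈ Finset.Ioi i,
      if hF.legPerm hn i < hF.legPerm hn j then (1 : ℤˣ) else -1) =
      ∏ j ∈ Finset.Ioi i, if (i : ℕ) < k ∧ (j : ℕ) < lam.colLen i then -1 else 1 := by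
    intro i
    refine Finset.prod_congr rfl fun j hj => ?_
    change (if hF.legOrder hn i < hF.legOrder hn j then (1 : ℤˣ) else -1) = _
    rcases hF.legOrder_lt hn (Finset.mem_Ioi.1 hj) with ⟨h1, h2, h3⟩ | ⟨h1, h2⟩
    · rw [if_neg h3.not_gt, if_pos ⟨h1, h2⟩]
    · rw [if_pos h2, if_neg h1]
  simp only [h]
  rw [Fin.prod_univ_add, Finset.prod_eq_one (s := Finset.univ) (f := fun i : Fin d => _), mul_one,
    ← Finset.prod_pow_eq_pow_sum]
  · refine Finset.prod_congr rfl fun i _ => ?_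
    rw [Finset.prod_ite, Finset.prod_const_one, mul_one, Finset.prod_const]
    congr 1
    have h1 := hF.2.2 i
    have h2 := lam.colLen_anti 0 i (Nat.zero_le _)
    have h3 : ((Finset.Ioi (Fin.castAdd d i)).filter fun j : Fin (k + d) =>
        ((Fin.castAdd d i : Fin (k + d)) : ℕ) < k ∧
          (j : ℕ) < lam.colLen (Fin.castAdd d i : Fin (k + d))).map Fin.valEmbedding =
        Finset.Ioo (i : ℕ) (lam.colLen i) := by
      ext j
      simp only [Finset.mem_map, Finset.mem_filter, Finset.mem_Ioi, Fin.val_castAdd,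
        Fin.valEmbedding_apply, Finset.mem_Ioo, Fin.lt_def]
      constructor
      · rintro ⟨j, ⟨h1, -, h2⟩, rfl⟩
        exact ⟨h1, h2⟩
      · rintro ⟨h4, h5⟩
        exact ⟨⟨j, by omega⟩, ⟨h4, i.2, h5⟩, rfl⟩
    rw [← Finset.card_map Fin.valEmbedding, h3, Nat.card_Ioo]
    omega
  · intro i _
    refine Finset.prod_eq_one fun j _ => if_neg ?_
    simp

end IsFrobenius

/-! ### Giambelli's formula -/

/-- The upper triangular Toeplitz matrix with entries `g_{l-j}`. -/
def toeplitz (g : ℕ → ℂ) (n : ℕ) : Matrix (Fin n) (Fin n) ℂ :=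
  Matrix.of fun j l => if (j : ℕ) ≤ l then g (l - j) else 0

theorem det_toeplitz {g : ℕ → ℂ} (g0 : g 0 = 1) (n : ℕ) : (toeplitz g n).det = 1 := by
  rw [Matrix.det_of_isUpperTriangular]
  · simp [toeplitz, g0]
  · intro i j hij
    exact if_neg (not_le.2 hij)

theorem sum_mul_toeplitz (f g : ℕ → ℂ) {n : ℕ} (l : Fin n) :
    ∑ j : Fin n, f j * toeplitz g n j l = ∑ j ∈ Finset.range (l + 1), f j * g (l - j) := by
  simp only [toeplitz, Matrix.of_apply]
  rw [Fin.sum_univ_eq_sum_range (fun j => f j * if j ≤ (l : ℕ) then g (l - j) else 0) n]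
  symm
  rw [← Finset.sum_subset (Finset.range_subset_range.2 (Nat.succ_le_of_lt l.2))]
  · refine Finset.sum_congr rfl fun j hj => ?_
    rw [if_pos (Nat.lt_succ_iff.1 (Finset.mem_range.1 hj))]
  · intro j _ hj
    rw [if_neg (fun h => hj (Finset.mem_range.2 (Nat.lt_succ_of_le h))), mul_zero]

/-- The row (h_{j-c})_j holds the coefficients of z^c H, and z^c H G = z^c: multiplication by the
Toeplitz matrix of G turns it into a unit vector. -/
theorem sum_elemSchur_sub_mul {t : ℕ → ℂ} {h g : ℕ → ℂ} (hh : schurSeries t = PowerSeries.mk h)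
    (hg : PowerSeries.mk h * PowerSeries.mk g = 1) (c l : ℕ) :
    ∑ j ∈ Finset.range (l + 1), elemSchur t ((j : ℤ) - c) * g (l - j) = if c = l then 1 else 0 := by
  rcases lt_or_ge l c with hlc | hlc
  · rw [if_neg (by omega)]
    refine Finset.sum_eq_zero fun j hj => ?_
    have := Finset.mem_range.1 hj
    rw [elemSchur_of_neg _ (by omega), zero_mul]
  · obtain ⟨e, rfl⟩ := Nat.exists_eq_add_of_le hlc
    rw [add_assoc, Finset.sum_range_add, Finset.sum_eq_zero, zero_add]
    · have h1 := congrArg (PowerSeries.coeff e) hg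
      rw [PowerSeries.coeff_mul, Finset.Nat.sum_antidiagonal_eq_sum_range_succ_mk,
        PowerSeries.coeff_one] at h1
      simp only [PowerSeries.coeff_mk] at h1
      rw [show (if c = c + e then (1 : ℂ) else 0) = if e = 0 then 1 else 0 from
        if_congr (by omega) rfl rfl, ← h1]
      refine Finset.sum_congr rfl fun j _ => ?_
      rw [show ((c + j : ℕ) : ℤ) - c = (j : ℕ) by push_cast; ring, elemSchur_natCast, hh,
        PowerSeries.coeff_mk, Nat.add_sub_add_left]
    · intro j hj
      have := Finset.mem_range.1 hj
      rw [elemSchur_of_neg _ (by omega), zero_mul]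

/-- Giambelli's formula. -/
theorem schur_eq_det_hookSum {t : ℕ → ℂ} {h g : ℕ → ℂ} (hh : schurSeries t = PowerSeries.mk h)
    (hg : PowerSeries.mk h * PowerSeries.mk g = 1) {lam : YoungDiagram} {k : ℕ}
    {α β : Fin k → ℕ} (hF : IsFrobenius lam α β) :
    schur lam t = (-1) ^ (∑ i, β i) *
      (Matrix.of fun i j : Fin k => hookSum h g (α i) (β j)).det := by
  have h0 : h 0 = 1 := by
    have := constantCoeff_schurSeries t
    rwa [hh, ← PowerSeries.coeff_zero_eq_constantCoeff_apply, PowerSeries.coeff_mk] at this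
  have g0 : g 0 = 1 := by
    have := congrArg (PowerSeries.coeff 0) hg
    simpa [PowerSeries.coeff_mul, h0] using this
  obtain ⟨d, hn⟩ := Nat.exists_eq_add_of_le hF.le_colLen
  have hschur : ∀ n, lam.colLen 0 = n → schur lam t = (Matrix.of fun i j : Fin n =>
      elemSchur t ((lam.rowLen i : ℤ) - (i : ℤ) + (j : ℤ))).det := by
    rintro _ rfl
    rfl
  rw [hschur _ hn]
  set M : Matrix (Fin (k + d)) (Fin (k + d)) ℂ := Matrix.of fun i j =>
      elemSchur t ((lam.rowLen i : ℤ) - (i : ℤ) + (j : ℤ)) with hM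
  have hleg : ∀ i, hF.legPerm hn i = hF.legOrder hn i := fun _ => rfl
  -- For i ≥ k one has λ_i ≤ i, so the row is H shifted by i - λ_i and becomes the unit vector at
  -- that place.
  have hlow : ∀ (i : Fin d) (l : Fin (k + d)), (M * toeplitz g (k + d)) (Fin.natAdd k i) l =
      if hF.legPerm hn (Fin.natAdd k i) = l then 1 else 0 := by
    intro i l
    have h1 : lam.rowLen (k + i) ≤ k + i := hF.rowLen_le (Nat.le_add_right _ _)
    have h2 : ((hF.legPerm hn (Fin.natAdd k i) : Fin (k + d)) : ℕ) = k + i - lam.rowLen (k + i) := by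
      rw [hleg]
      simp [IsFrobenius.legOrder]
    rw [Matrix.mul_apply]
    simp only [hM, Matrix.of_apply]
    rw [sum_mul_toeplitz (fun j => elemSchur t (_ - _ + (j : ℤ))) g l,
      if_congr (Fin.ext_iff (b := l)) rfl rfl, h2, ← sum_elemSchur_sub_mul hh hg]
    refine Finset.sum_congr rfl fun j _ => ?_
    congr 2
    rw [Nat.cast_sub h1]
    simp only [Fin.val_natAdd]
    ring
  -- For i < k the row starts at h_{α_i+1}, and its truncated convolution with G is the hook sum.
  have hhigh : ∀ (i : Fin k) (l : Fin (k + d)), (M * toeplitz g (k + d)) (Fin.castAdd d i) l =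
      hookSum h g (α i) l := by
    intro i l
    rw [Matrix.mul_apply]
    simp only [hM, Matrix.of_apply]
    rw [sum_mul_toeplitz (fun j => elemSchur t (_ - _ + (j : ℤ))) g l, hookSum]
    refine Finset.sum_congr rfl fun j _ => ?_
    rw [Fin.val_castAdd, hF.2.1 i, show ((i + 1 + α i : ℕ) : ℤ) - (i : ℕ) + j =
      (α i + 1 + j : ℕ) by push_cast; ring, elemSchur_natCast, hh, PowerSeries.coeff_mk]
  -- `legPerm` brings the columns β_j to the front, followed by the positions of the unit vectors,
  -- so the lower blocks are 0 and 1.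
  have hblock : (((M * toeplitz g (k + d)).submatrix id (hF.legPerm hn)).submatrix
      finSumFinEquiv finSumFinEquiv : Matrix (Fin k ⊕ Fin d) (Fin k ⊕ Fin d) ℂ) =
      Matrix.fromBlocks (Matrix.of fun i j : Fin k => hookSum h g (α i) (β j))
        (Matrix.of fun i j => hookSum h g (α i) (hF.legPerm hn (Fin.natAdd k j))) 0 1 := by
    ext i j
    rcases i with i | i <;> rcases j with j | j
    · have : ((hF.legPerm hn (Fin.castAdd d j) : Fin (k + d)) : ℕ) = β j := by
        rw [hleg]
        simp [IsFrobenius.legOrder]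
      simp [hhigh, this]
    · simp [hhigh]
    · simp [hlow, Fin.ext_iff]
      omega
    · simp [hlow, Matrix.one_apply]
  have hdet := congrArg Matrix.det hblock
  rw [Matrix.det_submatrix_equiv_self, Matrix.det_permute', Matrix.det_fromBlocks_zero₂₁,
    Matrix.det_one, mul_one, Matrix.det_mul, det_toeplitz g0, mul_one, hF.sign_legPerm hn] at hdet
  rw [← hdet]
  push_cast
  rw [← mul_assoc, ← mul_pow, neg_one_mul, neg_neg, one_pow, one_mul]

/-! ### Stretched times: splitting by colour -/

theorem mk_stretch {p : ℕ} (hp : p ≠ 0) (f : ℕ → ℂ) :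
    PowerSeries.mk (stretch p f) = PowerSeries.expand p hp (PowerSeries.mk f) := by
  ext n
  rw [PowerSeries.coeff_expand, PowerSeries.coeff_mk, PowerSeries.coeff_mk]
  rfl

/-- A term survives only if p divides both indices. Their sum is (a + b)p + r + s + 1 with 0 < r + s
+ 1 < 2p, which forces r + s + 1 = p; the surviving terms are then those with j ≡ s modulo p. -/
theorem hookSum_stretch (h g : ℕ → ℂ) {p r s : ℕ} (hr : r < p) (hs : s < p) (a b : ℕ) :
    hookSum (stretch p h) (stretch p g) (a * p + r) (b * p + s) =
      if r + s + 1 = p then hookSum h g a b else 0 := by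
  have hp : 0 < p := by omega
  have hdvd : ∀ j ∈ Finset.range (b * p + s + 1), p ∣ a * p + r + 1 + j → p ∣ b * p + s - j →
      r + s + 1 = p := by
    intro j hj h1 h2
    have h3 := dvd_add h1 h2
    have hj' := Finset.mem_range.1 hj
    rw [show a * p + r + 1 + j + (b * p + s - j) = (a + b) * p + (r + s + 1) by
      rw [add_mul]; omega, Nat.dvd_add_right (dvd_mul_left _ _)] at h3
    obtain ⟨c, hc⟩ := h3
    have : c = 1 := by
      have h4 : p * c < p * 2 := by omega
      have := Nat.lt_of_mul_lt_mul_left h4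
      rcases c with _ | _ | c
      · omega
      · rfl
      · omega
    rw [this, mul_one] at hc
    exact hc
  split_ifs with hrs
  · symm
    refine Finset.sum_of_injOn (fun j => s + p * j) ?_ ?_ ?_ ?_
    · intro x _ y _ hxy
      exact Nat.eq_of_mul_eq_mul_left hp (Nat.add_left_cancel hxy)
    · intro j hj
      have h1 := Nat.mul_le_mul_left p (Nat.lt_succ_iff.1 (Finset.mem_range.1 (Finset.mem_coe.1 hj)))
      rw [mul_comm p b] at h1
      simp only [Finset.coe_range, Set.mem_Iio]
      omega
    · intro j hj hj'
      by_contra hne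
      have h2 : p ∣ b * p + s - j := by
        by_contra hd
        exact hne (by simp [stretch, hd])
      obtain ⟨c, hc⟩ := h2
      have hjr := Finset.mem_range.1 hj
      have hcb : c ≤ b := by
        by_contra! hcb
        have := Nat.mul_le_mul_left p hcb
        rw [mul_comm b p] at hc
        rw [Nat.succ_eq_add_one, mul_add] at this
        omega
      refine hj' ⟨b - c, by simp, ?_⟩
      have : p * (b - c) + p * c = b * p := by
        rw [← mul_add, Nat.sub_add_cancel hcb, mul_comm]
      simp only
      omega
    · intro j hj
      have hjb := Nat.lt_succ_iff.1 (Finset.mem_range.1 hj)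
      have h1 : a * p + r + 1 + (s + p * j) = p * (a + 1 + j) := by
        rw [mul_add, mul_add, mul_one, mul_comm p a]; omega
      have h2 : b * p + s - (s + p * j) = p * (b - j) := by
        rw [Nat.mul_sub, mul_comm p b]; omega
      simp only [stretch, h1, h2, dvd_mul_right, if_true, Nat.mul_div_cancel_left _ hp]
  · refine Finset.sum_eq_zero fun j hj => ?_
    by_cases h1 : p ∣ a * p + r + 1 + j
    · by_cases h2 : p ∣ b * p + s - j
      · exact absurd (hdvd j hj h1 h2) hrs
      · simp [stretch, h2]
    · simp [stretch, h1]

theorem finSigmaFinEquiv_lt_of_lt {p : ℕ} {k : Fin p → ℕ} {m m' : Fin p} (hm : m < m')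
    (i : Fin (k m)) (j : Fin (k m')) :
    (finSigmaFinEquiv ⟨m, i⟩ : Fin (∑ m, k m)) < finSigmaFinEquiv ⟨m', j⟩ := by
  have hS : ∀ m : Fin p, ∑ t : Fin (m : ℕ), k (Fin.castLE m.2.le t) =
      ∑ t ∈ Finset.range m, if h : t < p then k ⟨t, h⟩ else 0 := by
    intro m
    rw [← Fin.sum_univ_eq_sum_range (fun t => if h : t < p then k ⟨t, h⟩ else 0)]
    refine Finset.sum_congr rfl fun t _ => ?_
    rw [dif_pos (by omega)]
    rfl
  rw [Fin.lt_def, finSigmaFinEquiv_apply, finSigmaFinEquiv_apply]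
  simp only
  rw [hS, hS]
  have h1 := Finset.sum_le_sum_of_subset (f := fun t => if h : t < p then k ⟨t, h⟩ else 0)
    (Finset.range_subset_range.2 (Nat.succ_le_of_lt (Fin.lt_def.1 hm)))
  rw [Finset.sum_range_succ, dif_pos m.2] at h1
  have := i.2
  simp only [Fin.eta] at h1
  omega

theorem finSigmaFinEquiv_lt_iff {p : ℕ} {k : Fin p → ℕ} {m : Fin p} (i j : Fin (k m)) :
    (finSigmaFinEquiv ⟨m, i⟩ : Fin (∑ m, k m)) < finSigmaFinEquiv ⟨m, j⟩ ↔ i < j := by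
  rw [Fin.lt_def, finSigmaFinEquiv_apply, finSigmaFinEquiv_apply]
  simp

/-- `finSigmaFinEquiv` lists the entries colour by colour. Sorting them decreasingly inverts no pair
of the same colour, as each `F m` already decreases, and inverts a pair of different colours exactly
when the earlier entry is the smaller one. -/
theorem sign_merge {p : ℕ} {k : Fin p → ℕ} (e : ((m : Fin p) × Fin (k m)) ≃ Fin (∑ m, k m))
    {α : Fin (∑ m, k m) → ℕ} (hα : StrictAnti α) {F : (m : Fin p) → Fin (k m) → ℕ}
    (he : ∀ x, α (e x) = F x.1 x.2) (hF : ∀ m, StrictAnti (F m)) :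
    Equiv.Perm.sign (finSigmaFinEquiv.symm.trans e) =
      (-1) ^ ∑ m, ∑ m' ∈ Finset.Ioi m, ∑ i, ∑ j, if F m i < F m' j then 1 else 0 := by
  have hpair : ∀ x y : (m : Fin p) × Fin (k m),
      (if finSigmaFinEquiv x < finSigmaFinEquiv y then
        (if e x < e y then (1 : ℤˣ) else -1) else 1) =
      if x.1 < y.1 then (-1) ^ (if F x.1 x.2 < F y.1 y.2 then 1 else 0) else 1 := by
    rintro ⟨m, i⟩ ⟨m', j⟩
    have h1 : e ⟨m, i⟩ < e ⟨m', j⟩ ↔ F m' j < F m i := by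
      rw [← he ⟨m, i⟩, ← he ⟨m', j⟩, hα.lt_iff_gt]
    rcases lt_trichotomy m m' with hm | rfl | hm
    · rw [if_pos (finSigmaFinEquiv_lt_of_lt hm i j), if_pos hm]
      have hne : F m i ≠ F m' j := by
        rw [← he ⟨m, i⟩, ← he ⟨m', j⟩]
        intro h
        exact hm.ne (congrArg Sigma.fst (e.injective (hα.injective h)))
      by_cases h2 : F m i < F m' j
      · rw [if_neg (by rw [h1]; omega), if_pos h2, pow_one]
      · rw [if_pos (by rw [h1]; omega), if_neg h2, pow_zero]
    · rw [if_neg (lt_irrefl _)]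
      split_ifs with h2 h3
      · rfl
      · rw [finSigmaFinEquiv_lt_iff] at h2
        exact absurd (h1.2 (hF m h2)) h3
      · rfl
    · rw [if_neg (finSigmaFinEquiv_lt_of_lt hm j i).not_gt, if_neg hm.not_gt]
  have hIoi : ∀ {n : ℕ} (i : Fin n) (f : Fin n → ℤˣ),
      ∏ j ∈ Finset.Ioi i, f j = ∏ j, if i < j then f j else 1 := by
    intro n i f
    rw [← Finset.prod_filter]
    congr 1
    ext j
    simp
  rw [Equiv.Perm.sign_eq_prod_prod_Ioi]
  simp only [hIoi]
  rw [← finSigmaFinEquiv.prod_comp]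
  simp_rw [← (finSigmaFinEquiv (n := k)).prod_comp (fun j => if _ < j then _ else _)]
  simp only [Equiv.trans_apply, Equiv.symm_apply_apply, hpair, Fintype.prod_sigma]
  simp only [← Finset.prod_pow_eq_pow_sum, hIoi]
  refine Finset.prod_congr rfl fun m _ => ?_
  rw [Finset.prod_comm]
  refine Finset.prod_congr rfl fun m' _ => ?_
  split_ifs
  · rfl
  · simp

/-- The merged sequence is known only through its range; this recovers the bijection between its
positions and the coloured indices. -/
theorem exists_merge_equiv {ι κ : Type*} {α : ι → ℕ} (hα : Function.Injective α) {F : κ → ℕ}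
    (hF : Function.Injective F) (h : Set.range α = Set.range F) : ∃ e : κ ≃ ι, ∀ x, α (e x) = F x := by
  have h1 : ∀ x, ∃ i, α i = F x := fun x =>
    (h.symm ▸ Set.mem_range_self x : F x ∈ Set.range α)
  choose e he using h1
  refine ⟨Equiv.ofBijective e ⟨fun x y hxy => hF (by rw [← he, ← he, hxy]), fun i => ?_⟩, he⟩
  obtain ⟨x, hx⟩ : α i ∈ Set.range F := h ▸ Set.mem_range_self i
  exact ⟨x, hα (by rw [he, hx])⟩

/-- The residue modulo p determines the colour, and the quotient then determines the index. -/
theorem interleave_injective {p : ℕ} {k : Fin p → ℕ} {A : (m : Fin p) → Fin (k m) → ℕ}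
    (hA : ∀ m, Function.Injective (A m)) {r : Fin p → ℕ} (hr : Function.Injective r)
    (hrp : ∀ m, r m < p) :
    Function.Injective fun x : (m : Fin p) × Fin (k m) => A x.1 x.2 * p + r x.1 := by
  rintro ⟨m, i⟩ ⟨m', j⟩ h
  simp only at h
  have h1 := congrArg (· % p) h
  simp only [Nat.mul_add_mod', Nat.mod_eq_of_lt (hrp _)] at h1
  obtain rfl := hr h1
  have h2 := Nat.eq_of_mul_eq_mul_right ((Nat.zero_le _).trans_lt (hrp m)) (Nat.add_right_cancel h)
  rw [hA m h2]

theorem det_sigma_block {p : ℕ} {k : Fin p → ℕ}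
    (N : (m : Fin p) → Matrix (Fin (k m)) (Fin (k m)) ℂ)
    (M : Matrix ((m : Fin p) × Fin (k m)) ((m : Fin p) × Fin (k m)) ℂ)
    (hd : ∀ m i j, M ⟨m, i⟩ ⟨m, j⟩ = N m i j) (ho : ∀ x y, x.1 ≠ y.1 → M x y = 0) :
    M.det = ∏ m, (N m).det := by
  have hB : M.BlockTriangular Sigma.fst := fun x y hxy => ho x y hxy.ne'
  rw [hB.det_fintype]
  refine Finset.prod_congr rfl fun m _ => ?_
  rw [← Matrix.det_submatrix_equiv_self (Equiv.sigmaSubtype m).symm]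
  congr 1
  ext i j
  exact hd m i j

/-- The residues m and p - 1 - m' add up to p - 1 only for m = m', so the Giambelli matrix is block
diagonal once sorted by colour. The factors (-1)^{B m j} cancel the sign in the closed forms of the
hook sums, at the price of the last sum in `signExponent`. -/
theorem schur_stretch {t h g : ℕ → ℂ} (hh : schurSeries t = PowerSeries.mk h)
    (hg : PowerSeries.mk h * PowerSeries.mk g = 1) {p : ℕ} (hp : 0 < p)
    {k : Fin p → ℕ} {A B : (m : Fin p) → Fin (k m) → ℕ}
    (hA : ∀ m, StrictAnti (A m)) (hB : ∀ m, StrictAnti (B m))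
    {α β : Fin (∑ m, k m) → ℕ} {lam : YoungDiagram} (hlam : IsFrobenius lam α β)
    (hα : Set.range α = {n : ℕ | ∃ (m : Fin p) (i : Fin (k m)), n = A m i * p + m})
    (hβ : Set.range β = {n : ℕ | ∃ (m : Fin p) (i : Fin (k m)), n = B m i * p + (p - 1 - m)}) :
    schur lam (stretch p t) = (-1) ^ signExponent p A B *
      ∏ m, (Matrix.of fun i j : Fin (k m) => (-1) ^ B m j * hookSum h g (A m i) (B m j)).det := by
  have hp0 : p ≠ 0 := hp.ne'
  have hh' : schurSeries (stretch p t) = PowerSeries.mk (stretch p h) := by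
    rw [schurSeries_stretch hp0, hh, mk_stretch hp0]
  have hg' : PowerSeries.mk (stretch p h) * PowerSeries.mk (stretch p g) = 1 := by
    rw [mk_stretch hp0, mk_stretch hp0, ← map_mul, hg, map_one]
  obtain ⟨eα, heα⟩ := exists_merge_equiv (α := α) hlam.strictAnti_left.injective
    (interleave_injective (fun m => (hA m).injective) (r := fun m => (m : ℕ)) Fin.val_injective
      (fun m => m.2)) (by rw [hα]; ext n; simp [eq_comm])
  obtain ⟨eβ, heβ⟩ := exists_merge_equiv (α := β) hlam.strictAnti_right.injective
    (interleave_injective (fun m => (hB m).injective) (r := fun m => p - 1 - (m : ℕ))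
      (fun m m' h => Fin.ext (by simp only at h; omega)) (fun m => by omega))
    (by rw [hβ]; ext n; simp [eq_comm])
  have sα := sign_merge eα hlam.strictAnti_left (F := fun m i => A m i * p + m) heα
    (fun m i j hij => Nat.add_lt_add_right (Nat.mul_lt_mul_of_pos_right (hA m hij) hp) _)
  have sβ := sign_merge eβ hlam.strictAnti_right (F := fun m i => B m i * p + (p - 1 - m)) heβ
    (fun m i j hij => Nat.add_lt_add_right (Nat.mul_lt_mul_of_pos_right (hB m hij) hp) _)
  have hsum : ∑ i, β i = ∑ m, ∑ i, (B m i * p + (p - 1 - m)) := by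
    rw [← eβ.sum_comp, Fintype.sum_sigma]
    exact Finset.sum_congr rfl fun m _ => Finset.sum_congr rfl fun i _ => heβ ⟨m, i⟩
  rw [schur_eq_det_hookSum hh' hg' hlam]
  set M : Matrix (Fin (∑ m, k m)) (Fin (∑ m, k m)) ℂ :=
    Matrix.of fun i j => hookSum (stretch p h) (stretch p g) (α i) (β j) with hM
  have hdet : (M.submatrix eα eβ).det =
      ∏ m, (Matrix.of fun i j : Fin (k m) => hookSum h g (A m i) (B m j)).det := by
    apply det_sigma_block
    · intro m i j
      simp only [hM, Matrix.submatrix_apply, Matrix.of_apply, heα, heβ]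
      rw [hookSum_stretch h g m.2 (by omega), if_pos (by omega)]
    · rintro ⟨m, i⟩ ⟨m', j⟩ hne
      simp only [hM, Matrix.submatrix_apply, Matrix.of_apply, heα, heβ]
      have : (m : ℕ) ≠ m' := fun h => hne (Fin.ext h)
      rw [hookSum_stretch h g m.2 (by omega), if_neg (by omega)]
  -- `eα` and `eβ` start from coloured indices; composing with the colour-by-colour listing turns
  -- them into permutations that have a sign.
  have hperm : (M.submatrix eα eβ).det =
      (Equiv.Perm.sign (finSigmaFinEquiv.symm.trans eα) : ℂ) *
        ((Equiv.Perm.sign (finSigmaFinEquiv.symm.trans eβ) : ℂ) * M.det) := by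
    rw [← Matrix.det_permute', ← Matrix.det_permute, Matrix.submatrix_submatrix,
      ← Matrix.det_submatrix_equiv_self finSigmaFinEquiv.symm (M.submatrix eα eβ),
      Matrix.submatrix_submatrix]
    rfl
  have hcol : ∀ m, (Matrix.of fun i j : Fin (k m) =>
      (-1) ^ B m j * hookSum h g (A m i) (B m j)).det =
      (-1) ^ (∑ i, B m i) * (Matrix.of fun i j : Fin (k m) => hookSum h g (A m i) (B m j)).det := by
    intro m
    rw [← Finset.prod_pow_eq_pow_sum]
    exact Matrix.det_mul_row (fun j => (-1 : ℂ) ^ B m j) _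
  simp only [hcol]
  have hsign : signExponent p A B =
      (∑ m, ∑ m' ∈ Finset.Ioi m, ∑ i, ∑ j,
        if A m i * p + (m : ℕ) < A m' j * p + m' then 1 else 0) +
      (∑ m, ∑ m' ∈ Finset.Ioi m, ∑ i, ∑ j,
        if B m i * p + (p - 1 - (m : ℕ)) < B m' j * p + (p - 1 - m') then 1 else 0) +
      (∑ m, ∑ i, (B m i * p + (p - 1 - m))) + ∑ m, ∑ i, B m i := by
    simp only [signExponent, Finset.sum_add_distrib]
  rw [Finset.prod_mul_distrib, Finset.prod_pow_eq_pow_sum, ← hdet, hperm, sα, sβ, hsum, hsign]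
  push_cast
  simp only [pow_add]
  generalize ∑ m, ∑ m' ∈ Finset.Ioi m, ∑ i, ∑ j,
    (if A m i * p + (m : ℕ) < A m' j * p + m' then 1 else 0) = a
  generalize ∑ m, ∑ m' ∈ Finset.Ioi m, ∑ i, ∑ j,
    (if B m i * p + (p - 1 - (m : ℕ)) < B m' j * p + (p - 1 - m') then 1 else 0) = b
  have hsq : ∀ n : ℕ, ((-1 : ℂ) ^ n) * (-1) ^ n = 1 := fun n => by
    rw [← mul_pow, neg_one_mul, neg_neg, one_pow]
  have hall : ∀ x y z : ℕ, ((-1 : ℂ) ^ x * (-1) ^ x) * ((-1) ^ y * (-1) ^ y) *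
      ((-1) ^ z * (-1) ^ z) = 1 := fun x y z => by rw [hsq, hsq, hsq, one_mul, one_mul]
  -- The signs of I_α, I_β and ∑ B occur twice and square to 1.
  linear_combination (-((-1 : ℂ) ^ ∑ m, ∑ i, (B m i * p + (p - 1 - m))) * M.det) *
    hall a b (∑ m, ∑ i, B m i)

/-! ### Evaluation of the blocks and the four formulas -/

/-- Row and column factors come out of the determinant and leave the Cauchy matrix at x_i = -(A_i +
1), y_j = B_j. -/
theorem det_hooks_geometric (u v : ℂ) {k : ℕ} (A B : Fin k → ℕ) :
    (Matrix.of fun i j : Fin k => (-1) ^ B j *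
      hookSum (fun n => (∏ i ∈ Finset.range n, (u + v * i)) / n.factorial)
        (fun n => (∏ i ∈ Finset.range n, (-u + v * i)) / n.factorial) (A i) (B j)).det =
    cauchyFactor A B *
      ∏ i, ((∏ l ∈ Finset.range (A i + 1), (u + v * l)) / (A i).factorial *
        ((∏ l ∈ Finset.range (B i), (u - v * (l + 1))) / (B i).factorial)) := by
  have hM : (Matrix.of fun i j : Fin k => (-1) ^ B j *
      hookSum (fun n => (∏ i ∈ Finset.range n, (u + v * i)) / n.factorial)
        (fun n => (∏ i ∈ Finset.range n, (-u + v * i)) / n.factorial) (A i) (B j)) =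
      Matrix.of fun i j : Fin k =>
        ((∏ l ∈ Finset.range (A i + 1), (u + v * l)) / (A i).factorial) *
        (Matrix.of fun i j : Fin k =>
          ((∏ l ∈ Finset.range (B j), (u - v * (l + 1))) / (B j).factorial) *
          (Matrix.of fun i j : Fin k => 1 / ((B j : ℂ) - -((A i : ℂ) + 1))) i j) i j := by
    ext i j
    simp only [Matrix.of_apply]
    rw [hookSum_geometric, ← mul_assoc, ← mul_pow, neg_one_mul, neg_neg, one_pow, one_mul,
      mul_assoc]
    congr 3
    ring
  rw [hM, Matrix.det_mul_column, Matrix.det_mul_row, det_cauchy, Finset.prod_mul_distrib,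
    cauchyFactor, Finset.prod_comm (f := fun i j => (A i : ℂ) + B j + 1)]
  · have h1 : ∏ i, ∏ j ∈ Finset.Ioi i, (-((A i : ℂ) + 1) - -((A j : ℂ) + 1)) * ((B j : ℂ) - B i) =
        ∏ i, ∏ j ∈ Finset.Ioi i, ((A i : ℂ) - A j) * ((B i : ℂ) - B j) :=
      Finset.prod_congr rfl fun i _ => Finset.prod_congr rfl fun j _ => by ring
    have h2 : ∏ i, ∏ j, ((B i : ℂ) - -((A j : ℂ) + 1)) = ∏ i, ∏ j, ((A j : ℂ) + B i + 1) :=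
      Finset.prod_congr rfl fun i _ => Finset.prod_congr rfl fun j _ => by ring
    rw [h1, h2]
    ring
  · intro i j
    rw [sub_neg_eq_add]
    exact_mod_cast (B j + A i).succ_ne_zero

/-- The Cauchy matrix is taken at x_i = q^{A_i+1}, y_j = q^{-B_j}. Writing 1 - q^{A_i+B_j+1} =
q^{B_j}(y_j - x_i) costs q^{-B_j}, which cancels the q taken out of each of the B_j factors q^{l+1}
- x. -/
theorem det_hooks_quantum {q : ℂ} (hq0 : q ≠ 0) (hq : ∀ n : ℕ, 0 < n → q ^ n ≠ 1) (x : ℂ)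
    {k : ℕ} (A B : Fin k → ℕ) :
    (Matrix.of fun i j : Fin k => (-1) ^ B j *
      hookSum (fun n => qPoch x q n / qPoch q q n)
        (fun n => (∏ i ∈ Finset.range n, (x - q ^ i)) / qPoch q q n) (A i) (B j)).det =
    qCauchyFactor q A B *
      ∏ i, (qPoch x q (A i + 1) / qPoch q q (A i) *
        ((∏ l ∈ Finset.range (B i), (q ^ l - x / q)) / qPoch q q (B i))) := by
  have hne : ∀ a b : ℕ, q ^ (-(b : ℤ)) - q ^ (a + 1) ≠ 0 := by
    intro a b h
    apply hq (a + b + 1) (Nat.succ_pos _)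
    rw [zpow_neg, zpow_natCast, sub_eq_zero] at h
    rw [show a + b + 1 = (a + 1) + b by omega, pow_add, ← h, inv_mul_cancel₀ (pow_ne_zero _ hq0)]
  have hM : (Matrix.of fun i j : Fin k => (-1) ^ B j *
      hookSum (fun n => qPoch x q n / qPoch q q n)
        (fun n => (∏ i ∈ Finset.range n, (x - q ^ i)) / qPoch q q n) (A i) (B j)) =
      Matrix.of fun i j : Fin k => (qPoch x q (A i + 1) / qPoch q q (A i)) *
        (Matrix.of fun i j : Fin k =>
          ((∏ l ∈ Finset.range (B j), (q ^ l - x / q)) / qPoch q q (B j)) *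
          (Matrix.of fun i j : Fin k => 1 / (q ^ (-(B j : ℤ)) - q ^ (A i + 1))) i j) i j := by
    ext i j
    simp only [Matrix.of_apply]
    have h1 : ∏ l ∈ Finset.range (B j), (q ^ (l + 1) - x) =
        q ^ B j * ∏ l ∈ Finset.range (B j), (q ^ l - x / q) := by
      conv_rhs => rw [← Finset.card_range (B j), ← Finset.prod_const, Finset.card_range]
      rw [← Finset.prod_mul_distrib]
      refine Finset.prod_congr rfl fun l _ => ?_
      field_simp
      ring
    have h2 : 1 / (1 - q ^ (A i + B j + 1)) =
        (q ^ B j)⁻¹ * (1 / (q ^ (-(B j : ℤ)) - q ^ (A i + 1))) := by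
      rw [one_div, one_div, ← mul_inv]
      congr 1
      rw [zpow_neg, zpow_natCast, mul_sub, mul_inv_cancel₀ (pow_ne_zero _ hq0)]
      ring
    have h3 : q ^ B j * (q ^ B j)⁻¹ = 1 := mul_inv_cancel₀ (pow_ne_zero _ hq0)
    rw [hookSum_quantum x hq, ← mul_assoc, ← mul_pow, neg_one_mul, neg_neg, one_pow, one_mul, h1, h2]
    linear_combination (qPoch x q (A i + 1) / qPoch q q (A i) *
      ((∏ l ∈ Finset.range (B j), (q ^ l - x / q)) / qPoch q q (B j)) *
        (1 / (q ^ (-(B j : ℤ)) - q ^ (A i + 1)))) * h3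
  rw [hM, Matrix.det_mul_column, Matrix.det_mul_row, det_cauchy _ _ fun i j => hne _ _,
    Finset.prod_mul_distrib, qCauchyFactor]
  ring

theorem prod_sub_mul_succ_eq_poch (a : ℂ) (b : ℕ) :
    ∏ l ∈ Finset.range b, (a - 1 * ((l : ℂ) + 1)) = (-1) ^ b * poch (1 - a) b := by
  conv_rhs => rw [← Finset.card_range b, ← Finset.prod_const, Finset.card_range]
  rw [poch, ← Finset.prod_mul_distrib]
  exact Finset.prod_congr rfl fun l _ => by ring

/-- No branch problem arises: for q ≠ 0 principal powers turn sums of exponents into products, and b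
is a natural number. -/
theorem prod_pow_sub_cpow_div (a : ℂ) {q : ℂ} (hq0 : q ≠ 0) (b : ℕ) :
    ∏ l ∈ Finset.range b, (q ^ l - q ^ a / q) =
      (-1) ^ b * q ^ ((a - 1) * (b : ℂ)) * qPoch (q ^ (1 - a)) q b := by
  have h1 : q ^ a / q = q ^ (a - 1) := by rw [Complex.cpow_sub _ _ hq0, Complex.cpow_one]
  have h2 : q ^ (a - 1) * q ^ (1 - a) = 1 := by
    rw [← Complex.cpow_add _ _ hq0, show a - 1 + (1 - a) = 0 by ring, Complex.cpow_zero]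
  rw [Complex.cpow_mul_nat, ← mul_pow, h1]
  conv_rhs => rw [← Finset.card_range b, ← Finset.prod_const, Finset.card_range]
  rw [qPoch, ← Finset.prod_mul_distrib]
  refine Finset.prod_congr rfl fun l _ => ?_
  linear_combination (-(q ^ l)) * h2

theorem lemma2 (p : ℕ) (hp : 0 < p)
    -- the partitions `(α^{(m)} | β^{(m)})`, `m = 1, …, p` (numbered from `0` here)
    (k : Fin p → ℕ) (A B : (m : Fin p) → Fin (k m) → ℕ)
    (μ : Fin p → YoungDiagram) (hμ : ∀ m, IsFrobenius (μ m) (A m) (B m))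
    -- the partition `(α | β)` obtained by merging
    (K : ℕ) (hK : K = ∑ m, k m) (α β : Fin K → ℕ)
    (lam : YoungDiagram) (hlam : IsFrobenius lam α β)
    (hα : Set.range α = {n : ℕ | ∃ (m : Fin p) (i : Fin (k m)), n = A m i * p + m})
    (hβ : Set.range β = {n : ℕ | ∃ (m : Fin p) (i : Fin (k m)), n = B m i * p + (p - 1 - m)}) :
    (schur lam (stretch p tInf) =
      (-1) ^ signExponent p A B *
        ∏ m, (cauchyFactor (A m) (B m) *
          (1 / ∏ i, ((A m i).factorial * (B m i).factorial : ℂ)))) ∧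
    (∀ a : ℂ, schur lam (stretch p (tA a)) =
      (-1) ^ signExponent p A B *
        ∏ m, (cauchyFactor (A m) (B m) *
          ∏ i, (poch a (A m i + 1) / (A m i).factorial *
            ((-1) ^ B m i * poch (1 - a) (B m i) / (B m i).factorial)))) ∧
    (∀ q : ℂ, q ≠ 0 → (∀ n : ℕ, 0 < n → q ^ n ≠ 1) →
      schur lam (stretch p (tInfQ q)) =
        (-1) ^ signExponent p A B *
          ∏ m, (qCauchyFactor q (A m) (B m) *
            ∏ i, (q ^ (B m i * (B m i - 1) / 2) /
              (qPoch q q (A m i) * qPoch q q (B m i)))) ∧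
      ∀ a : ℂ, schur lam (stretch p (tAQ a q)) =
        (-1) ^ signExponent p A B *
          ∏ m, (qCauchyFactor q (A m) (B m) *
            ∏ i, (qPoch (q ^ a) q (A m i + 1) / qPoch q q (A m i) *
              ((-1) ^ B m i * q ^ ((a - 1) * (B m i : ℂ)) * qPoch (q ^ (1 - a)) q (B m i) /
                qPoch q q (B m i))))) := by
  subst hK
  have hA := fun m => (hμ m).strictAnti_left
  have hB := fun m => (hμ m).strictAnti_right
  have geo : ∀ (t : ℕ → ℂ) (u v : ℂ), (∀ n : ℕ, t (n + 1) * (n + 1) = u * v ^ n) →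
      schur lam (stretch p t) = (-1) ^ signExponent p A B * ∏ m, (cauchyFactor (A m) (B m) *
        ∏ i, ((∏ l ∈ Finset.range (A m i + 1), (u + v * l)) / (A m i).factorial *
          ((∏ l ∈ Finset.range (B m i), (u - v * (l + 1))) / (B m i).factorial))) := by
    intro t u v ht
    rw [schur_stretch (schurSeries_of_geometric t u v ht) (mk_mul_mk_geometric u v) hp hA hB hlam
      hα hβ]
    simp only [det_hooks_geometric]
  refine ⟨?_, fun a => ?_, fun q hq0 hq => ?_⟩
  -- With v = 0 the convention 0^0 = 1 leaves only t_1 = 1.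
  · rw [geo tInf 1 0 fun n => by rcases n with _ | n <;> simp [tInf]]
    congr 1
    refine Finset.prod_congr rfl fun m _ => ?_
    rw [one_div, ← Finset.prod_inv_distrib]
    congr 1
    refine Finset.prod_congr rfl fun i _ => ?_
    simp [mul_comm]
  · rw [geo (tA a) a 1 fun n => by
      have : ((n : ℂ) + 1) ≠ 0 := by exact_mod_cast n.succ_ne_zero
      simp [tA, this]]
    simp only [prod_sub_mul_succ_eq_poch]
    simp only [one_mul, poch]
  have quantum : ∀ (t : ℕ → ℂ) (x : ℂ),
      (∀ n : ℕ, t (n + 1) * (n + 1) * (1 - q ^ (n + 1)) = 1 - x ^ (n + 1)) →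
      schur lam (stretch p t) = (-1) ^ signExponent p A B * ∏ m, (qCauchyFactor q (A m) (B m) *
        ∏ i, (qPoch x q (A m i + 1) / qPoch q q (A m i) *
          ((∏ l ∈ Finset.range (B m i), (q ^ l - x / q)) / qPoch q q (B m i)))) := by
    intro t x ht
    have hh : schurSeries t = PowerSeries.mk fun n => qPoch x q n / qPoch q q n := by
      ext n
      rw [coeff_schurSeries_of_q t q x hq ht, PowerSeries.coeff_mk]
    rw [schur_stretch hh (mk_mul_mk_quantum x hq) hp hA hB hlam hα hβ]
    simp only [det_hooks_quantum hq0 hq]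
  have hne : ∀ n : ℕ, ((n : ℂ) + 1) ≠ 0 ∧ 1 - q ^ (n + 1) ≠ 0 := fun n =>
    ⟨by exact_mod_cast n.succ_ne_zero, sub_ne_zero.2 (hq _ n.succ_pos).symm⟩
  refine ⟨?_, fun a => ?_⟩
  -- For x = 0 the Pochhammer symbols in x become 1, and ∏_{l<b} q^l = q^{b(b-1)/2}. The truncated b
  -- - 1 is harmless at b = 0, being multiplied by 0.
  · rw [quantum (tInfQ q) 0 fun n => by
      obtain ⟨h1, h2⟩ := hne n
      simp only [tInfQ, ne_eq, Nat.succ_ne_zero, not_false_eq_true, zero_pow, sub_zero]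
      push_cast
      field_simp]
    have h0 : ∀ n, qPoch 0 q n = 1 := fun n => by simp [qPoch]
    have hpow : ∀ n, ∏ l ∈ Finset.range n, q ^ l = q ^ (n * (n - 1) / 2) := fun n => by
      rw [Finset.prod_pow_eq_pow_sum, Finset.sum_range_id]
    simp only [zero_div, sub_zero, hpow, h0, one_div_mul_eq_div, div_div, mul_comm (qPoch q q (B _ _))]
  · rw [quantum (tAQ a q) (q ^ a) fun n => by
      obtain ⟨h1, h2⟩ := hne n
      simp only [tAQ]
      push_cast
      field_simp]
    simp only [prod_pow_sub_cpow_div a hq0]
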